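/- Let $M$ be a smooth manifold, $A\to M$ a Lie algebroid with anchor $a:A\to TM$, and $V\to M$ an $A$-module of rank one, with differential $d:\Gamma(V\otimes\wedge^kA^*)\to\Gamma(V\otimes\wedge^{k+1}A^*)$ (so $\iota_X dv=\mathcal L_Xv$ for $v\in\Gamma(V)$, and $\iota_X d\xi=\mathcal L_X\xi-d\iota_X\xi$ for $\xi\in\Gamma(V\otimes A^*)$, where $\iota_Y\mathcal L_X\xi=\mathcal L_X(\iota_Y\xi)-\iota_{[X,Y]}\xi$). Let $0\to V\otimes A^*\xrightarrow{j}\mathbb A\xrightarrow{\pi}A\to0$ be an $AV$-Courant algebroid: $\mathbb A$ is a smooth vector bundle with a $V$-valued symmetric bilinear form $\langle\cdot,\cdot\rangle$ on its fibres and an $\mathbb R$-bilinear bracket $[\![\cdot,\cdot]\!]$ on its sections, the sequence of bundle maps is exact, $\langle e,j(\xi)\rangle=\iota_{\pi(e)}\xi$, and for all sections $[\![e_1,[\![e_2,e_3]\!]]\!]=[\![[\![e_1,e_2]\!],e_3]\!]+[\![e_2,[\![e_1,e_3]\!]]\!]$, $\ \pi[\![e_1,e_2]\!]=[\pi e_1,\pi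 e_2]$, $\ [\![e,e]\!]=\tfrac12 j(d\langle e,e\rangle)$, and $\mathcal L_{\pi(e_1)}\langle e_2,e_3\rangle=\langle[\![e_1,e_2]\!],e_3\rangle+\langle e_2,[\![e_1,e_3]\!]\rangle$. Let $i:H\hookrightarrow A$ be a smooth subbundle, let $\mathbb H=\pi^{-1}(H)/j(V\otimes\mathrm{Ann}(H))$ with quotient map $q:\pi^{-1}(H)\to\mathbb H$ and the induced $V$-valued pairing, and write again $j:V\otimes H^*\to\mathbb H$ and $\pi:\mathbb H\to H$ for the induced maps. Let $\mathbb J\in\Gamma(\mathrm{Hom}(\mathbb H,\mathbb H))$ be a generalized CR structure: $\mathbb J$ preserves the pairing of $\mathbb H$, $\mathbb J^2=-1$, and $L=q^{-1}(\ker(\mathbb J-\sqrt{-1}))\subset\mathbb C\otimes\mathbb A$ is involutive for the complex bilinear extension of $[\![\cdot,\cdot]\!]$. Then the map $P=i\circ\pi\circ\mathbb J\circ j\circ(\mathrm{id}\otimes i^*):V\otimes A^*\to A$ is smooth, and it is skew, that is, $P(\xi,\eta):=\iota_{P(\xi)}\eta\in V$ satisfies $P(\xi,\eta)=-P(\eta,\xi)$,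 so that $P$ is an element of $\Gamma(V^*\otimes\wedge^2A)$ with $P(\xi,\cdot)=P(\xi)$. Moreover $V\otimes A^*$ is a Lie algebroid over $M$ with bracket $$[\xi,\eta]=\iota_{P(\xi,\cdot)}d\eta-\iota_{P(\eta,\cdot)}d\xi+d\bigl(P(\xi,\eta)\bigr),\qquad \xi,\eta\in\Gamma(V\otimes A^*),$$ and anchor $\xi\mapsto a(P(\xi,\cdot))$, and the map $\xi\mapsto P(\xi,\cdot)$, $V\otimes A^*\to A$, is a morphism of Lie algebroids. -/

import Mathlib

open scoped Manifold ContDiff Bundle TensorProduct Topology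

noncomputable section

namespace AVC

set_option linter.unusedSectionVars false

section Sections

variable {E : Type*} [NormedAddCommGroup E] [NormedSpace ℝ E]
  {HM : Type*} [TopologicalSpace HM] {I : ModelWithCorners ℝ E HM}
  {M : Type*} [TopologicalSpace M] [ChartedSpace HM M]
  {F : Type*} [NormedAddCommGroup F] [NormedSpace ℝ F]
  {A : M → Type*} [TopologicalSpace (Bundle.TotalSpace F A)]
  [∀ x, AddCommGroup (A x)] [∀ x, Module ℝ (A x)] [∀ x, TopologicalSpace (A x)]
  [FiberBundle F A] [VectorBundle ℝ F A]

instance : SMul C^∞⟮I, M; ℝ⟯ Cₛ^∞⟮I; F, A⟯ :=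
  ⟨fun f s ↦ ⟨fun x ↦ f x • s x, f.contMDiff.smul_section s.contMDiff⟩⟩

@[simp]
theorem smul_apply (f : C^∞⟮I, M; ℝ⟯) (s : Cₛ^∞⟮I; F, A⟯) (x : M) : (f • s) x = f x • s x := rfl

/-- Evaluation of sections at a point. -/
def evalAt (x : M) : Cₛ^∞⟮I; F, A⟯ →ₗ[ℝ] A x where
  toFun s := s x
  map_add' _ _ := rfl
  map_smul' _ _ := rfl

variable {F' : Type*} [NormedAddCommGroup F'] [NormedSpace ℝ F']
  {W : M → Type*} [TopologicalSpace (Bundle.TotalSpace F' W)]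
  [∀ x, AddCommGroup (W x)] [∀ x, Module ℝ (W x)] [∀ x, TopologicalSpace (W x)]
  [∀ x, IsTopologicalAddGroup (W x)] [∀ x, ContinuousSMul ℝ (W x)]
  [FiberBundle F' W] [VectorBundle ℝ F' W]

/-- A smooth section of `Hom(A, W)` applied to a smooth section of `A`. -/
def app (α : Cₛ^∞⟮I; F →L[ℝ] F', fun x ↦ A x →L[ℝ] W x⟯) (X : Cₛ^∞⟮I; F, A⟯) :
    Cₛ^∞⟮I; F', W⟯ :=
  ⟨fun x ↦ α x (X x), ContMDiff.clm_bundle_apply (b := id) α.contMDiff X.contMDiff⟩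

@[simp]
theorem app_apply (α : Cₛ^∞⟮I; F →L[ℝ] F', fun x ↦ A x →L[ℝ] W x⟯) (X : Cₛ^∞⟮I; F, A⟯)
    (x : M) : app α X x = α x (X x) := rfl

theorem app_add (α : Cₛ^∞⟮I; F →L[ℝ] F', fun x ↦ A x →L[ℝ] W x⟯) (X Y : Cₛ^∞⟮I; F, A⟯) :
    app α (X + Y) = app α X + app α Y := by
  ext x
  exact map_add (α x) _ _

theorem app_sub (α : Cₛ^∞⟮I; F →L[ℝ] F', fun x ↦ A x →L[ℝ] W x⟯) (X Y : Cₛ^∞⟮I; F, A⟯) :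
    app α (X - Y) = app α X - app α Y := by
  ext x
  exact map_sub (α x) _ _

theorem app_smul (α : Cₛ^∞⟮I; F →L[ℝ] F', fun x ↦ A x →L[ℝ] W x⟯) (f : C^∞⟮I, M; ℝ⟯)
    (X : Cₛ^∞⟮I; F, A⟯) : app α (f • X) = f • app α X := by
  ext x
  exact map_smul (α x) _ _

theorem add_app (α β : Cₛ^∞⟮I; F →L[ℝ] F', fun x ↦ A x →L[ℝ] W x⟯) (X : Cₛ^∞⟮I; F, A⟯) :
    app (α + β) X = app α X + app β X := rfl

theorem sub_app (α β : Cₛ^∞⟮I; F →L[ℝ] F', fun x ↦ A x →L[ℝ] W x⟯) (X : Cₛ^∞⟮I; F, A⟯) :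
    app (α - β) X = app α X - app β X := rfl

theorem smul_app (f : C^∞⟮I, M; ℝ⟯) (α : Cₛ^∞⟮I; F →L[ℝ] F', fun x ↦ A x →L[ℝ] W x⟯)
    (X : Cₛ^∞⟮I; F, A⟯) : app (f • α) X = f • app α X := rfl

variable [FiniteDimensional ℝ E] [IsManifold I ∞ M] [T2Space M] [FiniteDimensional ℝ F]
  [ContMDiffVectorBundle ∞ F A I]

/-- A smooth bump function supported in the domain of a bundle trivialization. -/
theorem exists_bump (F : Type*) [NormedAddCommGroup F] [NormedSpace ℝ F]
    (A : M → Type*) [TopologicalSpace (Bundle.TotalSpace F A)] [∀ x, TopologicalSpace (A x)]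
    [FiberBundle F A] (x₀ : M) :
    ∃ ψ : C^∞⟮I, M; ℝ⟯, (∀ᶠ x in 𝓝 x₀, ψ x = 1) ∧
      tsupport ψ ⊆ (trivializationAt F A x₀).baseSet := by
  obtain ⟨f, -, hf⟩ := (SmoothBumpFunction.nhds_basis_tsupport (I := I) x₀).mem_iff.1
    ((trivializationAt F A x₀).open_baseSet.mem_nhds
      (FiberBundle.mem_baseSet_trivializationAt F A x₀))
  exact ⟨⟨f, f.contMDiff⟩, f.eventuallyEq_one, hf⟩

/-- Around any point there are global smooth sections that form a frame near that point, such that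
every global section becomes a combination of them after multiplication by a smooth function that
is `1` near the point. -/
theorem exists_frame (x₀ : M) :
    ∃ (ψ : C^∞⟮I, M; ℝ⟯) (S : Module.Basis.ofVectorSpaceIndex ℝ F → Cₛ^∞⟮I; F, A⟯)
      (c : Cₛ^∞⟮I; F, A⟯ → Module.Basis.ofVectorSpaceIndex ℝ F → C^∞⟮I, M; ℝ⟯),
      ψ x₀ = 1 ∧
      (∀ X, ψ • (ψ • X) = ∑ i, c X i • S i) ∧
      (∀ X x i, X x = 0 → c X i x = 0) ∧
      (∀ᶠ x in 𝓝 x₀, ∀ i, S i x =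
        (trivializationAt F A x₀).symm x (Module.Basis.ofVectorSpace ℝ F i)) := by
  have : ContMDiffVectorBundle 1 F A I := .of_le (n := ∞) (by simp)
  obtain ⟨ψ, h1, hs⟩ := exists_bump (I := I) F A x₀
  set t := trivializationAt F A x₀
  set b := Module.Basis.ofVectorSpace ℝ F
  have hloc (i) : CMDiff[t.baseSet] ∞ (T% (t.localFrame b i)) :=
    t.contMDiffOn_localFrame_baseSet ∞ b i
  let S (i) : Cₛ^∞⟮I; F, A⟯ := ⟨fun x ↦ ψ x • t.localFrame b i x,
    ContMDiffOn.smul_section_of_tsupport ψ.contMDiff.contMDiffOn t.open_baseSet hs (hloc i)⟩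
  have hc (X : Cₛ^∞⟮I; F, A⟯) (i) : CMDiff ∞ (fun x ↦ ψ x • t.localFrameCoeff I b i x (X x)) := by
    apply contMDiff_of_tsupport
    intro x hx
    have hx' : x ∈ t.baseSet := hs (closure_mono (Function.support_smul_subset_left _ _) hx)
    exact (ψ.contMDiff x).smul (contMDiffAt_localFrameCoeff b hx' (X.contMDiff x) i)
  let c (X : Cₛ^∞⟮I; F, A⟯) (i) : C^∞⟮I, M; ℝ⟯ := ⟨_, hc X i⟩
  refine ⟨ψ, S, c, h1.self_of_nhds, ?_, ?_, ?_⟩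
  · intro X
    ext x
    have e1 : (∑ i, c X i • S i) x =
        ∑ i, (ψ x * t.localFrameCoeff I b i x (X x)) • (ψ x • t.localFrame b i x) :=
      map_sum (evalAt x) _ _
    rw [e1]
    by_cases hx : x ∈ t.baseSet
    · simp only [smul_apply]
      conv_lhs => rw [t.eq_sum_localFrameCoeff_smul (I := I) (b := b) (s := X) hx]
      simp only [Finset.smul_sum, smul_smul]
      refine Finset.sum_congr rfl fun i _ ↦ ?_
      congr 1
      ring
    · have : ψ x = 0 := image_eq_zero_of_notMem_tsupport fun h ↦ hx (hs h)
      simp [this]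
  · intro X x i hx
    change ψ x • t.localFrameCoeff I b i x (X x) = 0
    simp [hx]
  · filter_upwards [h1, t.open_baseSet.mem_nhds
      (FiberBundle.mem_baseSet_trivializationAt F A x₀)] with x hx hx' i
    change ψ x • t.localFrame b i x = _
    simp [hx, hx', Bundle.Trivialization.basisAt]

theorem exists_section_eq (x₀ : M) (v : A x₀) : ∃ X : Cₛ^∞⟮I; F, A⟯, X x₀ = v := by
  obtain ⟨ψ, S, c, -, -, -, hS⟩ := exists_frame (I := I) (F := F) (A := A) x₀
  set t := trivializationAt F A x₀
  set b := Module.Basis.ofVectorSpace ℝ F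
  have hx : x₀ ∈ t.baseSet := FiberBundle.mem_baseSet_trivializationAt F A x₀
  refine ⟨∑ i, b.repr (t.continuousLinearMapAt ℝ x₀ v) i • S i, ?_⟩
  have e1 : (∑ i, b.repr (t.continuousLinearMapAt ℝ x₀ v) i • S i) x₀ =
      ∑ i, b.repr (t.continuousLinearMapAt ℝ x₀ v) i • S i x₀ := map_sum (evalAt x₀) _ _
  have e2 : v = t.symmL ℝ x₀ (∑ i, b.repr (t.continuousLinearMapAt ℝ x₀ v) i • b i) := by
    rw [b.sum_repr, t.symmL_continuousLinearMapAt hx]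
  rw [e1]
  conv_rhs => rw [e2]
  simp only [map_sum, map_smul, hS.self_of_nhds]
  simp only [t.symmL_apply hx]

theorem tensorial_eq_zero (Φ : Cₛ^∞⟮I; F, A⟯ → Cₛ^∞⟮I; F', W⟯)
    (hadd : ∀ X Y, Φ (X + Y) = Φ X + Φ Y)
    (hsmul : ∀ (f : C^∞⟮I, M; ℝ⟯) X, Φ (f • X) = f • Φ X)
    (x : M) (X : Cₛ^∞⟮I; F, A⟯) (hX : X x = 0) : Φ X x = 0 := by
  obtain ⟨ψ, S, c, h1, hc, hc0, -⟩ := exists_frame (I := I) (F := F) (A := A) x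
  have h2 := congrArg (fun Y ↦ Φ Y x) (hc X)
  simp only [hsmul, smul_apply, h1, one_smul] at h2
  let Φ' : Cₛ^∞⟮I; F, A⟯ →+ Cₛ^∞⟮I; F', W⟯ := AddMonoidHom.mk' Φ hadd
  have h3 : Φ (∑ i, c X i • S i) x = ∑ i, (c X i • Φ (S i)) x := by
    change Φ' _ x = _
    rw [map_sum]
    refine (map_sum (evalAt x) _ _).trans (Finset.sum_congr rfl fun i _ ↦ ?_)
    exact congrArg (fun Y ↦ Y x) (hsmul _ _)
  rw [h2, h3]
  simp [hc0 X x _ hX]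

theorem exists_hom_section (Φ : Cₛ^∞⟮I; F, A⟯ → Cₛ^∞⟮I; F', W⟯)
    (hadd : ∀ X Y, Φ (X + Y) = Φ X + Φ Y)
    (hsmul : ∀ (f : C^∞⟮I, M; ℝ⟯) X, Φ (f • X) = f • Φ X) :
    ∃ α : Cₛ^∞⟮I; F →L[ℝ] F', fun x ↦ A x →L[ℝ] W x⟯, ∀ X, app α X = Φ X := by
  have key (x : M) (X Y : Cₛ^∞⟮I; F, A⟯) (h : X x = Y x) : Φ X x = Φ Y x := by
    let Φ' : Cₛ^∞⟮I; F, A⟯ →+ Cₛ^∞⟮I; F', W⟯ := AddMonoidHom.mk' Φ hadd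
    have := tensorial_eq_zero Φ hadd hsmul x (X - Y) (by simp [h])
    have h2 : Φ (X - Y) = Φ X - Φ Y := map_sub Φ' X Y
    rwa [h2, ContMDiffSection.coe_sub, Pi.sub_apply, sub_eq_zero] at this
  choose ext hext using fun x (v : A x) ↦ exists_section_eq (I := I) (F := F) x v
  have hreal (r : ℝ) (X : Cₛ^∞⟮I; F, A⟯) : Φ (r • X) = r • Φ X :=
    hsmul (ContMDiffMap.const r) X
  let L (x : M) : A x →ₗ[ℝ] W x :=
    { toFun v := Φ (ext x v) x
      map_add' v w := by
        rw [key x (ext x (v + w)) (ext x v + ext x w) (by simp [hext]), hadd]; rfl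
      map_smul' r v := by
        rw [key x (ext x (r • v)) (r • ext x v) (by simp [hext]), hreal]; rfl }
  let Lc (x : M) : A x →L[ℝ] W x := (L x).comp
    ((VectorBundle.continuousLinearEquivAt ℝ F A x).symm.toLinearMap) |>.toContinuousLinearMap.comp
    (VectorBundle.continuousLinearEquivAt ℝ F A x).toContinuousLinearMap
  have hLc (x : M) (X : Cₛ^∞⟮I; F, A⟯) : Lc x (X x) = Φ X x := by
    have : Lc x (X x) = Φ (ext x (X x)) x := by
      change L x ((VectorBundle.continuousLinearEquivAt ℝ F A x).symm
        (VectorBundle.continuousLinearEquivAt ℝ F A x (X x))) = _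
      rw [ContinuousLinearEquiv.symm_apply_apply]
      rfl
    rw [this]
    exact key x _ _ (hext _ _)
  refine ⟨⟨Lc, fun x₀ ↦ ?_⟩, fun X ↦ ?_⟩
  · obtain ⟨-, S, -, -, -, -, hS⟩ := exists_frame (I := I) (F := F) (A := A) x₀
    rw [contMDiffAt_hom_bundle]
    refine ⟨contMDiffAt_id, ?_⟩
    set b := Module.Basis.ofVectorSpace ℝ F
    set T : M → F →L[ℝ] F' := fun x ↦ ContinuousLinearMap.inCoordinates F A F' W x₀ x x₀ x (Lc x)
    have hT : T = fun x ↦ ∑ i, ContinuousLinearMap.smulRightL ℝ F F'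
        (LinearMap.toContinuousLinearMap (b.coord i)) (T x (b i)) := by
      funext x
      ext v
      conv_lhs => rw [← b.sum_repr v]
      simp only [map_sum, map_smul]
      simp
    change CMDiffAt ∞ T x₀
    rw [hT]
    refine ContMDiffAt.sum fun i _ ↦ ?_
    refine (ContinuousLinearMap.contMDiff _).contMDiffAt.comp x₀ ?_
    refine ((Bundle.contMDiffAt_section x₀).1 ((Φ (S i)).contMDiff x₀)).congr_of_eventuallyEq ?_
    filter_upwards [hS, (trivializationAt F A x₀).open_baseSet.mem_nhds
      (FiberBundle.mem_baseSet_trivializationAt F A x₀),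
      (trivializationAt F' W x₀).open_baseSet.mem_nhds
      (FiberBundle.mem_baseSet_trivializationAt F' W x₀)] with x hx h1 h2
    simp only [T]
    rw [ContinuousLinearMap.inCoordinates_eq h1 h2, ← hLc x (S i), hx i]
    simp [Bundle.Trivialization.symm_apply, h1, b]
  · ext x
    exact hLc x X

/-- The smooth section of `Hom(A, W)` given by a `C^∞(M)`-linear map `Γ(A) → Γ(W)`. -/
def ofTensorial (Φ : Cₛ^∞⟮I; F, A⟯ → Cₛ^∞⟮I; F', W⟯)
    (hadd : ∀ X Y, Φ (X + Y) = Φ X + Φ Y)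
    (hsmul : ∀ (f : C^∞⟮I, M; ℝ⟯) X, Φ (f • X) = f • Φ X) :
    Cₛ^∞⟮I; F →L[ℝ] F', fun x ↦ A x →L[ℝ] W x⟯ :=
  (exists_hom_section Φ hadd hsmul).choose

theorem app_ofTensorial (Φ : Cₛ^∞⟮I; F, A⟯ → Cₛ^∞⟮I; F', W⟯)
    (hadd : ∀ X Y, Φ (X + Y) = Φ X + Φ Y)
    (hsmul : ∀ (f : C^∞⟮I, M; ℝ⟯) X, Φ (f • X) = f • Φ X) (X : Cₛ^∞⟮I; F, A⟯) :
    app (ofTensorial Φ hadd hsmul) X = Φ X :=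
  (exists_hom_section Φ hadd hsmul).choose_spec X

/-- A section of `Hom(A, W)` is determined by its values on the sections of `A`. -/
theorem hom_section_ext {α β : Cₛ^∞⟮I; F →L[ℝ] F', fun x ↦ A x →L[ℝ] W x⟯}
    (h : ∀ X, app α X = app β X) : α = β := by
  ext x v
  obtain ⟨X, rfl⟩ := exists_section_eq (I := I) (F := F) x v
  exact congrArg (fun Y ↦ Y x) (h X)

end Sections

section Algebroids

variable {E : Type*} [NormedAddCommGroup E] [NormedSpace ℝ E]
  {HM : Type*} [TopologicalSpace HM] {I : ModelWithCorners ℝ E HM}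
  {M : Type*} [TopologicalSpace M] [ChartedSpace HM M] [IsManifold I ∞ M]

/-- A Lie algebroid structure on the smooth vector bundle `A → M`. -/
structure LieAlgebroid (I : ModelWithCorners ℝ E HM) [IsManifold I ∞ M]
    (F : Type*) [NormedAddCommGroup F] [NormedSpace ℝ F]
    (A : M → Type*) [TopologicalSpace (Bundle.TotalSpace F A)]
    [∀ x, AddCommGroup (A x)] [∀ x, Module ℝ (A x)] [∀ x, TopologicalSpace (A x)]
    [FiberBundle F A] [VectorBundle ℝ F A] where
  /-- the anchor `a : A → TM`, a smooth bundle map -/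
  anchor : Cₛ^∞⟮I; F →L[ℝ] E, fun x ↦ A x →L[ℝ] TangentSpace I x⟯
  /-- the bracket on sections -/
  bracket : Cₛ^∞⟮I; F, A⟯ →ₗ[ℝ] Cₛ^∞⟮I; F, A⟯ →ₗ[ℝ] Cₛ^∞⟮I; F, A⟯
  bracket_self : ∀ X, bracket X X = 0
  jacobi : ∀ X Y Z, bracket X (bracket Y Z) = bracket (bracket X Y) Z + bracket Y (bracket X Z)
  leibniz : ∀ (X : Cₛ^∞⟮I; F, A⟯) (f : C^∞⟮I, M; ℝ⟯) (Y : Cₛ^∞⟮I; F, A⟯) (x : M),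
    bracket X (f • Y) x = f x • bracket X Y x + mvfderiv I f x (anchor x (X x)) • Y x
  anchor_bracket : ∀ (X Y : Cₛ^∞⟮I; F, A⟯) (x : M), anchor x (bracket X Y x) =
    VectorField.mlieBracket I (fun y ↦ anchor y (X y)) (fun y ↦ anchor y (Y y)) x

variable {F : Type*} [NormedAddCommGroup F] [NormedSpace ℝ F]
  {A : M → Type*} [TopologicalSpace (Bundle.TotalSpace F A)]
  [∀ x, AddCommGroup (A x)] [∀ x, Module ℝ (A x)] [∀ x, TopologicalSpace (A x)]
  [∀ x, IsTopologicalAddGroup (A x)] [∀ x, ContinuousSMul ℝ (A x)]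
  [FiberBundle F A] [VectorBundle ℝ F A]

theorem LieAlgebroid.bracket_skew (𝓐 : LieAlgebroid I F A) (X Y : Cₛ^∞⟮I; F, A⟯) :
    𝓐.bracket X Y = -𝓐.bracket Y X := by
  have h := 𝓐.bracket_self (X + Y)
  simp only [map_add, LinearMap.add_apply, 𝓐.bracket_self, zero_add, add_zero] at h
  exact eq_neg_of_add_eq_zero_right h

/-- A smooth bundle map `Φ : B → A` over the identity of `M` is a morphism of Lie algebroids if it
is compatible with the anchors and the brackets. -/
structure IsLieAlgebroidMorphism
    {G : Type*} [NormedAddCommGroup G] [NormedSpace ℝ G]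
    {B : M → Type*} [TopologicalSpace (Bundle.TotalSpace G B)]
    [∀ x, AddCommGroup (B x)] [∀ x, Module ℝ (B x)] [∀ x, TopologicalSpace (B x)]
    [FiberBundle G B] [VectorBundle ℝ G B]
    (𝓑 : LieAlgebroid I G B) (𝓐 : LieAlgebroid I F A)
    (Φ : Cₛ^∞⟮I; G →L[ℝ] F, fun x ↦ B x →L[ℝ] A x⟯) : Prop where
  anchor_comp : ∀ x (b : B x), 𝓐.anchor x (Φ x b) = 𝓑.anchor x b
  map_bracket : ∀ X Y, app Φ (𝓑.bracket X Y) = 𝓐.bracket (app Φ X) (app Φ Y)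

/-- An `A`-module structure on the smooth vector bundle `V`: a `C^∞(M)`-linear Lie algebra
homomorphism `Γ(A) → End(Γ(V))` satisfying the Leibniz rule. -/
structure LieAlgebroidModule (𝓐 : LieAlgebroid I F A)
    (FV : Type*) [NormedAddCommGroup FV] [NormedSpace ℝ FV]
    (V : M → Type*) [TopologicalSpace (Bundle.TotalSpace FV V)]
    [∀ x, AddCommGroup (V x)] [∀ x, Module ℝ (V x)] [∀ x, TopologicalSpace (V x)]
    [FiberBundle FV V] [VectorBundle ℝ FV V] where
  /-- the Lie derivative of sections of `V` -/
  lie : Cₛ^∞⟮I; F, A⟯ →ₗ[ℝ] Cₛ^∞⟮I; FV, V⟯ →ₗ[ℝ] Cₛ^∞⟮I; FV, V⟯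
  lie_smul_left : ∀ (f : C^∞⟮I, M; ℝ⟯) X v, lie (f • X) v = f • lie X v
  leibniz : ∀ (X : Cₛ^∞⟮I; F, A⟯) (f : C^∞⟮I, M; ℝ⟯) (v : Cₛ^∞⟮I; FV, V⟯) (x : M),
    lie X (f • v) x = f x • lie X v x + mvfderiv I f x (𝓐.anchor x (X x)) • v x
  lie_bracket : ∀ X Y v, lie (𝓐.bracket X Y) v = lie X (lie Y v) - lie Y (lie X v)

variable [FiniteDimensional ℝ E] [T2Space M] [FiniteDimensional ℝ F]
  [ContMDiffVectorBundle ∞ F A I]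
  {𝓐 : LieAlgebroid I F A}
  {FV : Type*} [NormedAddCommGroup FV] [NormedSpace ℝ FV]
  {V : M → Type*} [TopologicalSpace (Bundle.TotalSpace FV V)]
  [∀ x, AddCommGroup (V x)] [∀ x, Module ℝ (V x)] [∀ x, TopologicalSpace (V x)]
  [∀ x, IsTopologicalAddGroup (V x)] [∀ x, ContinuousSMul ℝ (V x)]
  [FiberBundle FV V] [VectorBundle ℝ FV V] [ContMDiffVectorBundle ∞ FV V I]

namespace LieAlgebroidModule

variable (𝓥 : LieAlgebroidModule 𝓐 FV V)

/-- The differential `d : Γ(V) → Γ(V ⊗ A^*)`, with `ι_X (d v) = 𝓛_X v`. -/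
def d₀ (v : Cₛ^∞⟮I; FV, V⟯) : Cₛ^∞⟮I; F →L[ℝ] FV, fun x ↦ A x →L[ℝ] V x⟯ :=
  ofTensorial (fun X ↦ 𝓥.lie X v) (fun X Y ↦ by simp) (fun f X ↦ 𝓥.lie_smul_left f X v)

theorem app_d₀ (v : Cₛ^∞⟮I; FV, V⟯) (X : Cₛ^∞⟮I; F, A⟯) : app (𝓥.d₀ v) X = 𝓥.lie X v :=
  app_ofTensorial _ _ _ X

/-- The Lie derivative on `Γ(V ⊗ A^*)`: it is determined by `[𝓛_X, ι_Y] = ι_{[X,Y]}`, that is,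
`ι_Y (𝓛_X η) = 𝓛_X (ι_Y η) - ι_{[X,Y]} η`. -/
def lieForm (X : Cₛ^∞⟮I; F, A⟯) (η : Cₛ^∞⟮I; F →L[ℝ] FV, fun x ↦ A x →L[ℝ] V x⟯) :
    Cₛ^∞⟮I; F →L[ℝ] FV, fun x ↦ A x →L[ℝ] V x⟯ :=
  ofTensorial (fun Y ↦ 𝓥.lie X (app η Y) - app η (𝓐.bracket X Y))
    (fun Y Z ↦ by
      rw [app_add, map_add, map_add, app_add]
      abel)
    (fun f Y ↦ by
      ext x
      change 𝓥.lie X (app η (f • Y)) x - η x (𝓐.bracket X (f • Y) x) =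
        f x • (𝓥.lie X (app η Y) x - η x (𝓐.bracket X Y x))
      rw [app_smul, 𝓥.leibniz, 𝓐.leibniz, map_add, map_smul, map_smul, app_apply]
      module)

theorem app_lieForm (X Y : Cₛ^∞⟮I; F, A⟯)
    (η : Cₛ^∞⟮I; F →L[ℝ] FV, fun x ↦ A x →L[ℝ] V x⟯) :
    app (𝓥.lieForm X η) Y = 𝓥.lie X (app η Y) - app η (𝓐.bracket X Y) :=
  app_ofTensorial _ _ _ Y

/-- The differential `d : Γ(V ⊗ A^*) → Γ(V ⊗ ∧² A^*)`, with `ι_X d η = 𝓛_X η - d (ι_X η)`. Here a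
`V`-valued 2-form is regarded as a section of `Hom(A, Hom(A, V))`, so that `app (d₁ η) X` is the
interior product `ι_X (d η)`. -/
def d₁ (η : Cₛ^∞⟮I; F →L[ℝ] FV, fun x ↦ A x →L[ℝ] V x⟯) :
    Cₛ^∞⟮I; F →L[ℝ] F →L[ℝ] FV, fun x ↦ A x →L[ℝ] A x →L[ℝ] V x⟯ :=
  ofTensorial (fun X ↦ 𝓥.lieForm X η - 𝓥.d₀ (app η X))
    (fun X Y ↦ by
      refine hom_section_ext fun Z ↦ ?_
      rw [add_app, sub_app, sub_app, sub_app]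
      simp only [app_lieForm, app_d₀, map_add, LinearMap.add_apply, app_add]
      abel)
    (fun f X ↦ by
      refine hom_section_ext fun Z ↦ ?_
      rw [smul_app, sub_app, sub_app]
      simp only [app_lieForm, app_d₀]
      rw [𝓐.bracket_skew (f • X) Z, 𝓐.bracket_skew X Z, 𝓥.lie_smul_left, app_smul]
      ext x
      change f x • 𝓥.lie X (app η Z) x - η x (-(𝓐.bracket Z (f • X) x)) -
        𝓥.lie Z (f • app η X) x = f x • (𝓥.lie X (app η Z) x - η x (-(𝓐.bracket Z X x)) -
        𝓥.lie Z (app η X) x)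
      rw [𝓥.leibniz, 𝓐.leibniz, map_neg, map_neg, map_add, map_smul, map_smul, app_apply]
      module)

theorem app_d₁ (X : Cₛ^∞⟮I; F, A⟯) (η : Cₛ^∞⟮I; F →L[ℝ] FV, fun x ↦ A x →L[ℝ] V x⟯) :
    app (𝓥.d₁ η) X = 𝓥.lieForm X η - 𝓥.d₀ (app η X) :=
  app_ofTensorial _ _ _ X

end LieAlgebroidModule

/-- An `AV`-Courant algebroid: a smooth vector bundle `C` with a `V`-valued symmetric pairing, a
bracket on sections and an exact sequence `0 → V ⊗ A^* → C → A → 0`, where `V ⊗ A^*` is the bundle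
`Hom(A, V)`. -/
structure AVCourantAlgebroid (𝓥 : LieAlgebroidModule 𝓐 FV V)
    (FC : Type*) [NormedAddCommGroup FC] [NormedSpace ℝ FC]
    (C : M → Type*) [TopologicalSpace (Bundle.TotalSpace FC C)]
    [∀ x, AddCommGroup (C x)] [∀ x, Module ℝ (C x)] [∀ x, TopologicalSpace (C x)]
    [∀ x, IsTopologicalAddGroup (C x)] [∀ x, ContinuousSMul ℝ (C x)]
    [FiberBundle FC C] [VectorBundle ℝ FC C] where
  /-- the pairing `⟨·, ·⟩` -/
  pairing : Cₛ^∞⟮I; FC →L[ℝ] FC →L[ℝ] FV, fun x ↦ C x →L[ℝ] C x →L[ℝ] V x⟯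
  /-- the bracket on sections -/
  bracket : Cₛ^∞⟮I; FC, C⟯ →ₗ[ℝ] Cₛ^∞⟮I; FC, C⟯ →ₗ[ℝ] Cₛ^∞⟮I; FC, C⟯
  /-- the map `j : V ⊗ A^* → C` -/
  inj : Cₛ^∞⟮I; (F →L[ℝ] FV) →L[ℝ] FC, fun x ↦ (A x →L[ℝ] V x) →L[ℝ] C x⟯
  /-- the map `π : C → A` -/
  proj : Cₛ^∞⟮I; FC →L[ℝ] F, fun x ↦ C x →L[ℝ] A x⟯
  pairing_symm : ∀ x (e₁ e₂ : C x), pairing x e₁ e₂ = pairing x e₂ e₁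
  inj_injective : ∀ x, Function.Injective (inj x)
  proj_eq_zero_iff : ∀ x (e : C x), proj x e = 0 ↔ ∃ ξ, inj x ξ = e
  proj_surjective : ∀ x, Function.Surjective (proj x)
  pairing_inj : ∀ x (e : C x) (ξ : A x →L[ℝ] V x), pairing x e (inj x ξ) = ξ (proj x e)
  jacobi : ∀ e₁ e₂ e₃, bracket e₁ (bracket e₂ e₃) =
    bracket (bracket e₁ e₂) e₃ + bracket e₂ (bracket e₁ e₃)
  proj_bracket : ∀ e₁ e₂, app proj (bracket e₁ e₂) = 𝓐.bracket (app proj e₁) (app proj e₂)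
  bracket_self : ∀ e, bracket e e = (1 / 2 : ℝ) • app inj (𝓥.d₀ (app (app pairing e) e))
  lie_pairing : ∀ e₁ e₂ e₃, 𝓥.lie (app proj e₁) (app (app pairing e₂) e₃) =
    app (app pairing (bracket e₁ e₂)) e₃ + app (app pairing e₂) (bracket e₁ e₃)

/-- A family of subspaces of the fibres of `A` is a smooth subbundle if around every point it is
spanned by finitely many smooth sections that are linearly independent near that point. -/
def IsSmoothSubbundle (I : ModelWithCorners ℝ E HM) (F : Type*) [NormedAddCommGroup F]
    [NormedSpace ℝ F] {A : M → Type*} [TopologicalSpace (Bundle.TotalSpace F A)]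
    [∀ x, AddCommGroup (A x)] [∀ x, Module ℝ (A x)] [∀ x, TopologicalSpace (A x)]
    [FiberBundle F A] [VectorBundle ℝ F A] (H : ∀ x, Submodule ℝ (A x)) : Prop :=
  ∀ x₀, ∃ (k : ℕ) (s : Fin k → Cₛ^∞⟮I; F, A⟯), ∀ᶠ x in 𝓝 x₀,
    LinearIndependent ℝ (fun i ↦ s i x) ∧ Submodule.span ℝ (Set.range fun i ↦ s i x) = H x

variable {𝓥 : LieAlgebroidModule 𝓐 FV V}
  {FC : Type*} [NormedAddCommGroup FC] [NormedSpace ℝ FC]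
  {C : M → Type*} [TopologicalSpace (Bundle.TotalSpace FC C)]
  [∀ x, AddCommGroup (C x)] [∀ x, Module ℝ (C x)] [∀ x, TopologicalSpace (C x)]
  [∀ x, IsTopologicalAddGroup (C x)] [∀ x, ContinuousSMul ℝ (C x)]
  [FiberBundle FC C] [VectorBundle ℝ FC C]

namespace AVCourantAlgebroid

variable (𝓒 : AVCourantAlgebroid 𝓥 FC C) (H : ∀ x, Submodule ℝ (A x))

/-- The fibre of `π⁻¹(H)`. -/
def preimage (x : M) : Submodule ℝ (C x) := (H x).comap (𝓒.proj x).toLinearMap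

/-- The fibre of `V ⊗ Ann(H)`. -/
def annihilator (V : M → Type*) [∀ x, AddCommGroup (V x)] [∀ x, Module ℝ (V x)]
    [∀ x, TopologicalSpace (V x)] [∀ x, IsTopologicalAddGroup (V x)] [∀ x, ContinuousSMul ℝ (V x)]
    (H : ∀ x, Submodule ℝ (A x)) (x : M) : Submodule ℝ (A x →L[ℝ] V x) where
  carrier := {ξ | ∀ a ∈ H x, ξ a = 0}
  zero_mem' _ _ := rfl
  add_mem' h h' a ha := by simp [h a ha, h' a ha]
  smul_mem' r ξ h a ha := by simp [h a ha]

/-- The fibre of `j(V ⊗ Ann(H))`, as a subspace of the fibre of `π⁻¹(H)`. -/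
def injAnnihilator (x : M) : Submodule ℝ (𝓒.preimage H x) :=
  ((annihilator V H x).map (𝓒.inj x).toLinearMap).submoduleOf (𝓒.preimage H x)

/-- The fibre of `ℍ = π⁻¹(H) / j(V ⊗ Ann(H))`. -/
abbrev Quot (x : M) : Type _ := 𝓒.preimage H x ⧸ 𝓒.injAnnihilator H x

/-- The quotient map `q : π⁻¹(H) → ℍ`. -/
def q (x : M) : 𝓒.preimage H x →ₗ[ℝ] 𝓒.Quot H x := (𝓒.injAnnihilator H x).mkQ

theorem proj_inj (x : M) (ξ : A x →L[ℝ] V x) : 𝓒.proj x (𝓒.inj x ξ) = 0 :=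
  (𝓒.proj_eq_zero_iff x _).2 ⟨ξ, rfl⟩

theorem inj_mem_preimage (x : M) (ξ : A x →L[ℝ] V x) : 𝓒.inj x ξ ∈ 𝓒.preimage H x := by
  change 𝓒.proj x (𝓒.inj x ξ) ∈ H x
  rw [proj_inj]
  exact zero_mem _

/-- The pairing of `π⁻¹(H)`. -/
def preimagePairing (x : M) : 𝓒.preimage H x →ₗ[ℝ] 𝓒.preimage H x →ₗ[ℝ] V x :=
  LinearMap.mk₂ ℝ (fun e₁ e₂ ↦ 𝓒.pairing x e₁ e₂) (by simp) (by simp) (by simp) (by simp)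

theorem preimagePairing_eq_zero (x : M) (e u : 𝓒.preimage H x) (hu : u ∈ 𝓒.injAnnihilator H x) :
    𝓒.preimagePairing H x e u = 0 := by
  obtain ⟨ξ, hξ, h⟩ := hu
  change 𝓒.pairing x e u = 0
  have h' : 𝓒.inj x ξ = u := h
  rw [← h', 𝓒.pairing_inj]
  exact hξ _ e.2

/-- The pairing of `ℍ` induced by the pairing of `C`: `⟨q u, q v⟩ = ⟨u, v⟩`. -/
def quotPairing (x : M) : 𝓒.Quot H x →ₗ[ℝ] 𝓒.Quot H x →ₗ[ℝ] V x :=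
  (𝓒.injAnnihilator H x).liftQ
    (LinearMap.flip ((𝓒.injAnnihilator H x).liftQ (𝓒.preimagePairing H x).flip fun u hu ↦ by
      ext e
      exact 𝓒.preimagePairing_eq_zero H x e u hu))
    fun u hu ↦ by
      ext e
      exact (𝓒.pairing_symm x _ _).trans (𝓒.preimagePairing_eq_zero H x e u hu)

theorem quotPairing_q (x : M) (u v : 𝓒.preimage H x) :
    𝓒.quotPairing H x (𝓒.q H x u) (𝓒.q H x v) = 𝓒.pairing x u v := rfl

/-- The composition `V ⊗ A^* → V ⊗ H^* → ℍ` of the restriction map `id ⊗ i^*` and the map `j`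
induced on `V ⊗ H^*`; it sends `ξ` to `q (j ξ)`. -/
def quotInj (x : M) : (A x →L[ℝ] V x) →ₗ[ℝ] 𝓒.Quot H x :=
  (𝓒.q H x).comp ((𝓒.inj x).toLinearMap.codRestrict _ (𝓒.inj_mem_preimage H x))

/-- The composition `ℍ → H → A` of the map induced by `π` and the inclusion `i`. -/
def quotProj (x : M) : 𝓒.Quot H x →ₗ[ℝ] A x :=
  (𝓒.injAnnihilator H x).liftQ ((𝓒.proj x).toLinearMap.domRestrict _) fun u hu ↦ by
    obtain ⟨ξ, -, h⟩ := hu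
    have h' : 𝓒.inj x ξ = u := h
    change 𝓒.proj x u = 0
    rw [← h', proj_inj]

/-- A section of the quotient bundle `ℍ` is smooth if it is the image under `q` of a smooth section
of the subbundle `π⁻¹(H) ⊆ C`. -/
def IsSmoothQuotSection (s : ∀ x, 𝓒.Quot H x) : Prop :=
  ∃ e : Cₛ^∞⟮I; FC, C⟯, ∀ x, ∃ h : e x ∈ 𝓒.preimage H x, s x = 𝓒.q H x ⟨e x, h⟩

variable {H} in
/-- The fibre of `L = q⁻¹(ker (J - i)) ⊆ ℂ ⊗ C`. -/
def complexSubbundle (J : ∀ x, 𝓒.Quot H x →ₗ[ℝ] 𝓒.Quot H x) (x : M) :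
    Submodule ℂ (ℂ ⊗[ℝ] C x) :=
  ((LinearMap.ker ((J x).baseChange ℂ - Complex.I • LinearMap.id)).comap
    ((𝓒.q H x).baseChange ℂ)).map ((𝓒.preimage H x).subtype.baseChange ℂ)

/-- A family of subspaces of `ℂ ⊗ C` is involutive if its smooth sections are closed under the
complex bilinear extension of the bracket. The space of smooth sections of `ℂ ⊗ C` is
`ℂ ⊗ Γ(C)`. -/
def IsInvolutive (L : ∀ x, Submodule ℂ (ℂ ⊗[ℝ] C x)) : Prop :=
  ∀ s t : ℂ ⊗[ℝ] Cₛ^∞⟮I; FC, C⟯,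
    (∀ x, (evalAt x).baseChange ℂ s ∈ L x) → (∀ x, (evalAt x).baseChange ℂ t ∈ L x) →
    ∀ x, (evalAt x).baseChange ℂ (LinearMap.BilinMap.baseChange ℂ 𝓒.bracket s t) ∈ L x

/-- A generalized CR structure on `C` with respect to the distinguished subbundle `H ⊆ A`. -/
structure GeneralizedCRStructure where
  /-- the endomorphism of `ℍ` -/
  J : ∀ x, 𝓒.Quot H x →ₗ[ℝ] 𝓒.Quot H x
  /-- smoothness: the induced map on sections of `ℍ` preserves the smooth sections -/
  smooth : ∀ s : ∀ x, 𝓒.Quot H x, 𝓒.IsSmoothQuotSection H s →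
    𝓒.IsSmoothQuotSection H fun x ↦ J x (s x)
  orthogonal : ∀ x u v, 𝓒.quotPairing H x (J x u) (J x v) = 𝓒.quotPairing H x u v
  sq : ∀ x u, J x (J x u) = -u
  involutive : 𝓒.IsInvolutive (𝓒.complexSubbundle J)

variable {𝓒 H}

/-- The map `i ∘ π ∘ 𝕁 ∘ j ∘ i^* : V ⊗ A^* → A`. -/
def GeneralizedCRStructure.bivector (𝕁 : 𝓒.GeneralizedCRStructure H) (x : M) :
    (A x →L[ℝ] V x) →ₗ[ℝ] A x :=
  𝓒.quotProj H x ∘ₗ 𝕁.J x ∘ₗ 𝓒.quotInj H x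

end AVCourantAlgebroid

end Algebroids
end AVC

end

open scoped Manifold ContDiff Bundle TensorProduct Topology

noncomputable section

/-! For a 1-form ξ choose a smooth lift e of 𝕁 q jξ to π⁻¹(H). Since 𝕁² = -1, the section jξ - i e
lies in L, and πe = Pξ. Let e' be such a lift for η. Because [jξ, jη] = 0, the bracket of jξ - i e
and jη - i e' is -[e, e'] - i([jξ, e'] + [e, jη]). Nondegeneracy of the pairing and its invariance
compute the mixed terms: their sum is j[ξ, η] (`inj_bivectorBracket`). Involutivity now says that
[e, e'] is a lift of 𝕁 q j[ξ, η] (`Represents.bracket`).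

Everything else follows from this. Applying π shows that P preserves brackets. Iterating the formula
for j[ξ, η] turns the Jacobi identity for 1-forms into the sum of three Jacobi identities of the
Courant bracket, each with one e replaced by jξ, jη or jζ. Skewness of P is the skewness of 𝕁, an
orthogonal map with square -1. -/

namespace AVC

set_option linter.unusedSectionVars false

/-! ### Real and imaginary parts in a complexified vector space. -/

section RealImaginaryParts

variable (W W' : Type*) [AddCommGroup W] [Module ℝ W] [AddCommGroup W'] [Module ℝ W']

/-- The real part of an element of the complexification of a real vector space. -/
def tensorRe : ℂ ⊗[ℝ] W →ₗ[ℝ] W := (TensorProduct.lid ℝ W).toLinearMap ∘ₗ Complex.reLm.rTensor W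

/-- The imaginary part of an element of the complexification of a real vector space. -/
def tensorIm : ℂ ⊗[ℝ] W →ₗ[ℝ] W := (TensorProduct.lid ℝ W).toLinearMap ∘ₗ Complex.imLm.rTensor W

variable {W W'}

@[simp]
theorem tensorRe_tmul (z : ℂ) (w : W) : tensorRe W (z ⊗ₜ w) = z.re • w := by simp [tensorRe]

@[simp]
theorem tensorIm_tmul (z : ℂ) (w : W) : tensorIm W (z ⊗ₜ w) = z.im • w := by simp [tensorIm]

theorem tensorRe_baseChange (f : W →ₗ[ℝ] W') (z : ℂ ⊗[ℝ] W) :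
    tensorRe W' (f.baseChange ℂ z) = f (tensorRe W z) := by
  induction z with
  | zero => simp
  | tmul z w => simp
  | add x y hx hy => simp [hx, hy]

theorem tensorIm_baseChange (f : W →ₗ[ℝ] W') (z : ℂ ⊗[ℝ] W) :
    tensorIm W' (f.baseChange ℂ z) = f (tensorIm W z) := by
  induction z with
  | zero => simp
  | tmul z w => simp
  | add x y hx hy => simp [hx, hy]

theorem tensorRe_I_smul (z : ℂ ⊗[ℝ] W) : tensorRe W (Complex.I • z) = -tensorIm W z := by
  induction z with
  | zero => simp
  | tmul z w => simp [TensorProduct.smul_tmul']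
  | add x y hx hy => rw [smul_add, map_add, hx, hy, map_add, neg_add]

end RealImaginaryParts

/-! ### Sections of Hom bundles. -/

section Sections

variable {E : Type*} [NormedAddCommGroup E] [NormedSpace ℝ E]
  {HM : Type*} [TopologicalSpace HM] {I : ModelWithCorners ℝ E HM}
  {M : Type*} [TopologicalSpace M] [ChartedSpace HM M]
  {F : Type*} [NormedAddCommGroup F] [NormedSpace ℝ F]
  {A : M → Type*} [TopologicalSpace (Bundle.TotalSpace F A)]
  [∀ x, AddCommGroup (A x)] [∀ x, Module ℝ (A x)] [∀ x, TopologicalSpace (A x)]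
  [FiberBundle F A] [VectorBundle ℝ F A]
  {F' : Type*} [NormedAddCommGroup F'] [NormedSpace ℝ F']
  {W : M → Type*} [TopologicalSpace (Bundle.TotalSpace F' W)]
  [∀ x, AddCommGroup (W x)] [∀ x, Module ℝ (W x)] [∀ x, TopologicalSpace (W x)]
  [∀ x, IsTopologicalAddGroup (W x)] [∀ x, ContinuousSMul ℝ (W x)]
  [FiberBundle F' W] [VectorBundle ℝ F' W]

theorem app_zero (α : Cₛ^∞⟮I; F →L[ℝ] F', fun x ↦ A x →L[ℝ] W x⟯) :
    app α (0 : Cₛ^∞⟮I; F, A⟯) = 0 := by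
  ext x
  exact map_zero (α x)

theorem app_real_smul (α : Cₛ^∞⟮I; F →L[ℝ] F', fun x ↦ A x →L[ℝ] W x⟯) (r : ℝ)
    (X : Cₛ^∞⟮I; F, A⟯) : app α (r • X) = r • app α X := by
  ext x
  exact map_smul (α x) _ _

theorem real_smul_app (r : ℝ) (α : Cₛ^∞⟮I; F →L[ℝ] F', fun x ↦ A x →L[ℝ] W x⟯)
    (X : Cₛ^∞⟮I; F, A⟯) : app (r • α) X = r • app α X := rfl

theorem ofTensorial_apply [FiniteDimensional ℝ E] [IsManifold I ∞ M] [T2Space M]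
    [FiniteDimensional ℝ F] [ContMDiffVectorBundle ∞ F A I]
    (Φ : Cₛ^∞⟮I; F, A⟯ → Cₛ^∞⟮I; F', W⟯) (hadd : ∀ X Y, Φ (X + Y) = Φ X + Φ Y)
    (hsmul : ∀ (f : C^∞⟮I, M; ℝ⟯) X, Φ (f • X) = f • Φ X) (X : Cₛ^∞⟮I; F, A⟯) (x : M) :
    ofTensorial Φ hadd hsmul x (X x) = Φ X x := by
  rw [← app_apply, app_ofTensorial]

/-- The fibres of `Hom(A, W)` separate the points of `A` if `W` is nonzero. -/
theorem eq_zero_of_forall_hom_eq_zero (F F' : Type*) [NormedAddCommGroup F] [NormedSpace ℝ F]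
    [NormedAddCommGroup F'] [NormedSpace ℝ F'] [Nontrivial F']
    {A W : M → Type*} [TopologicalSpace (Bundle.TotalSpace F A)]
    [∀ x, AddCommGroup (A x)] [∀ x, Module ℝ (A x)] [∀ x, TopologicalSpace (A x)]
    [FiberBundle F A] [VectorBundle ℝ F A] [TopologicalSpace (Bundle.TotalSpace F' W)]
    [∀ x, AddCommGroup (W x)] [∀ x, Module ℝ (W x)] [∀ x, TopologicalSpace (W x)]
    [FiberBundle F' W] [VectorBundle ℝ F' W] (x : M) (v : A x)
    (h : ∀ η : A x →L[ℝ] W x, η v = 0) : v = 0 := by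
  obtain ⟨w, hw⟩ := exists_ne (0 : F')
  let a := VectorBundle.continuousLinearEquivAt ℝ F A x
  let b := VectorBundle.continuousLinearEquivAt ℝ F' W x
  by_contra hv
  obtain ⟨f, hf⟩ := SeparatingDual.exists_ne_zero (R := ℝ) (x := a v) (by simpa using hv)
  -- The rank-one map `f ⊗ w`, carried to the fibres at `x` by the trivializations.
  have h1 := h ((b.symm : F' →L[ℝ] W x) ∘L (f.smulRight w) ∘L (a : A x →L[ℝ] F))
  have h2 : b.symm (f (a v) • w) = 0 := h1
  simp [hf, hw] at h2

end Sections

section Algebroids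

variable {E : Type*} [NormedAddCommGroup E] [NormedSpace ℝ E] [FiniteDimensional ℝ E]
  {HM : Type*} [TopologicalSpace HM] {I : ModelWithCorners ℝ E HM}
  {M : Type*} [TopologicalSpace M] [ChartedSpace HM M] [IsManifold I ∞ M] [T2Space M]
  {F : Type*} [NormedAddCommGroup F] [NormedSpace ℝ F] [FiniteDimensional ℝ F]
  {A : M → Type*} [TopologicalSpace (Bundle.TotalSpace F A)]
  [∀ x, AddCommGroup (A x)] [∀ x, Module ℝ (A x)] [∀ x, TopologicalSpace (A x)]
  [∀ x, IsTopologicalAddGroup (A x)] [∀ x, ContinuousSMul ℝ (A x)]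
  [FiberBundle F A] [VectorBundle ℝ F A] [ContMDiffVectorBundle ∞ F A I]
  {FV : Type*} [NormedAddCommGroup FV] [NormedSpace ℝ FV]
  {V : M → Type*} [TopologicalSpace (Bundle.TotalSpace FV V)]
  [∀ x, AddCommGroup (V x)] [∀ x, Module ℝ (V x)] [∀ x, TopologicalSpace (V x)]
  [∀ x, IsTopologicalAddGroup (V x)] [∀ x, ContinuousSMul ℝ (V x)]
  [FiberBundle FV V] [VectorBundle ℝ FV V] [ContMDiffVectorBundle ∞ FV V I]
  {𝓐 : LieAlgebroid I F A}

/-! ### Cartan calculus and the bracket of V-valued 1-forms defined by P. -/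

namespace LieAlgebroidModule

variable (𝓥 : LieAlgebroidModule 𝓐 FV V)

theorem d₀_add (v w : Cₛ^∞⟮I; FV, V⟯) : 𝓥.d₀ (v + w) = 𝓥.d₀ v + 𝓥.d₀ w :=
  hom_section_ext fun X ↦ by simp only [add_app, app_d₀, map_add]

theorem d₀_smul (r : ℝ) (v : Cₛ^∞⟮I; FV, V⟯) : 𝓥.d₀ (r • v) = r • 𝓥.d₀ v :=
  hom_section_ext fun X ↦ by simp only [real_smul_app, app_d₀, map_smul]

theorem d₀_zero : 𝓥.d₀ 0 = 0 :=
  hom_section_ext fun X ↦ by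
    rw [app_d₀, map_zero]
    rfl

theorem lieForm_add (X : Cₛ^∞⟮I; F, A⟯) (η ζ : Cₛ^∞⟮I; F →L[ℝ] FV, fun x ↦ A x →L[ℝ] V x⟯) :
    𝓥.lieForm X (η + ζ) = 𝓥.lieForm X η + 𝓥.lieForm X ζ :=
  hom_section_ext fun Y ↦ by
    simp only [add_app, app_lieForm, map_add]
    abel

theorem lieForm_real_smul (X : Cₛ^∞⟮I; F, A⟯) (r : ℝ)
    (η : Cₛ^∞⟮I; F →L[ℝ] FV, fun x ↦ A x →L[ℝ] V x⟯) :
    𝓥.lieForm X (r • η) = r • 𝓥.lieForm X η :=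
  hom_section_ext fun Y ↦ by simp only [real_smul_app, app_lieForm, map_smul, smul_sub]

/-- In ι_Y 𝓛_X η the term η([X, Y]) is C^∞-linear in η, so the derivative of f comes only from 𝓛_X(f
η(Y)). -/
theorem lieForm_smul_apply (X : Cₛ^∞⟮I; F, A⟯) (f : C^∞⟮I, M; ℝ⟯)
    (η : Cₛ^∞⟮I; F →L[ℝ] FV, fun x ↦ A x →L[ℝ] V x⟯) (x : M) :
    𝓥.lieForm X (f • η) x =
      f x • 𝓥.lieForm X η x + mvfderiv I f x (𝓐.anchor x (X x)) • η x := by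
  ext v
  obtain ⟨Y, rfl⟩ := exists_section_eq (I := I) (F := F) x v
  have h1 := congrArg (fun s ↦ s x) (𝓥.app_lieForm X Y (f • η))
  have h2 := congrArg (fun s ↦ s x) (𝓥.app_lieForm X Y η)
  simp only [app_apply, smul_app, ContMDiffSection.coe_sub, Pi.sub_apply, smul_apply,
    𝓥.leibniz] at h1 h2
  simp only [add_apply, _root_.smul_apply, h1, h2]
  module

/-- The interior product `ι_X (d η)`, in terms of the Lie derivative. -/
theorem app_d₁_add_d₀ (X : Cₛ^∞⟮I; F, A⟯) (η : Cₛ^∞⟮I; F →L[ℝ] FV, fun x ↦ A x →L[ℝ] V x⟯) :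
    app (𝓥.d₁ η) X + 𝓥.d₀ (app η X) = 𝓥.lieForm X η := by
  rw [app_d₁, sub_add_cancel]

theorem d₁_add (η ζ : Cₛ^∞⟮I; F →L[ℝ] FV, fun x ↦ A x →L[ℝ] V x⟯) :
    𝓥.d₁ (η + ζ) = 𝓥.d₁ η + 𝓥.d₁ ζ :=
  hom_section_ext fun X ↦ by
    simp only [add_app, app_d₁, lieForm_add, d₀_add]
    abel

theorem d₁_smul (r : ℝ) (η : Cₛ^∞⟮I; F →L[ℝ] FV, fun x ↦ A x →L[ℝ] V x⟯) :
    𝓥.d₁ (r • η) = r • 𝓥.d₁ η :=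
  hom_section_ext fun X ↦ by
    simp only [real_smul_app, app_d₁, lieForm_real_smul, d₀_smul]
    module

/-- The bracket of `V`-valued 1-forms determined by a bivector `P`. -/
def bivectorBracket
    (P : Cₛ^∞⟮I; (F →L[ℝ] FV) →L[ℝ] F, fun x ↦ (A x →L[ℝ] V x) →L[ℝ] A x⟯) :
    Cₛ^∞⟮I; F →L[ℝ] FV, fun x ↦ A x →L[ℝ] V x⟯ →ₗ[ℝ]
      Cₛ^∞⟮I; F →L[ℝ] FV, fun x ↦ A x →L[ℝ] V x⟯ →ₗ[ℝ]
      Cₛ^∞⟮I; F →L[ℝ] FV, fun x ↦ A x →L[ℝ] V x⟯ :=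
  LinearMap.mk₂ ℝ (fun ξ η ↦ app (𝓥.d₁ η) (app P ξ) - app (𝓥.d₁ ξ) (app P η) +
      𝓥.d₀ (app η (app P ξ)))
    (fun ξ ξ' η ↦ by
      simp only [app_add, add_app, d₁_add, d₀_add]
      abel)
    (fun r ξ η ↦ by
      simp only [app_real_smul, real_smul_app, d₁_smul, d₀_smul]
      module)
    (fun ξ η η' ↦ by
      simp only [app_add, add_app, d₁_add, d₀_add]
      abel)
    (fun r ξ η ↦ by
      simp only [app_real_smul, real_smul_app, d₁_smul, d₀_smul]
      module)

/-- Cartan's formula 𝓛_X = ι_X d + d ι_X absorbs the exact term. In this form the two summands match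
the two mixed Courant brackets, and the second is C^∞-linear in η. -/
theorem bivectorBracket_eq
    (P : Cₛ^∞⟮I; (F →L[ℝ] FV) →L[ℝ] F, fun x ↦ (A x →L[ℝ] V x) →L[ℝ] A x⟯)
    (ξ η : Cₛ^∞⟮I; F →L[ℝ] FV, fun x ↦ A x →L[ℝ] V x⟯) :
    𝓥.bivectorBracket P ξ η = 𝓥.lieForm (app P ξ) η - app (𝓥.d₁ ξ) (app P η) := by
  rw [← app_d₁_add_d₀]
  change app (𝓥.d₁ η) (app P ξ) - app (𝓥.d₁ ξ) (app P η) + 𝓥.d₀ (app η (app P ξ)) = _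
  abel

/-- Skewness gives ξ(Pξ) = 0, so 𝓛_{Pξ} ξ and ι_{Pξ} dξ agree. -/
theorem bivectorBracket_self
    (P : Cₛ^∞⟮I; (F →L[ℝ] FV) →L[ℝ] F, fun x ↦ (A x →L[ℝ] V x) →L[ℝ] A x⟯)
    (hP : ∀ x (ξ η : A x →L[ℝ] V x), η (P x ξ) = -ξ (P x η))
    (ξ : Cₛ^∞⟮I; F →L[ℝ] FV, fun x ↦ A x →L[ℝ] V x⟯) : 𝓥.bivectorBracket P ξ ξ = 0 := by
  have h : app ξ (app P ξ) = 0 := by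
    ext x
    have h1 := hP x (ξ x) (ξ x)
    have h2 : (2 : ℝ) • ξ x (P x (ξ x)) = 0 := by
      rw [two_smul]
      exact eq_neg_iff_add_eq_zero.1 h1
    exact (smul_eq_zero.1 h2).resolve_left two_ne_zero
  rw [bivectorBracket_eq, app_d₁, h, d₀_zero, sub_zero, sub_self]

theorem bivectorBracket_leibniz
    (P : Cₛ^∞⟮I; (F →L[ℝ] FV) →L[ℝ] F, fun x ↦ (A x →L[ℝ] V x) →L[ℝ] A x⟯)
    (ξ : Cₛ^∞⟮I; F →L[ℝ] FV, fun x ↦ A x →L[ℝ] V x⟯) (f : C^∞⟮I, M; ℝ⟯)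
    (η : Cₛ^∞⟮I; F →L[ℝ] FV, fun x ↦ A x →L[ℝ] V x⟯) (x : M) :
    𝓥.bivectorBracket P ξ (f • η) x = f x • 𝓥.bivectorBracket P ξ η x +
      mvfderiv I f x (𝓐.anchor x (P x (ξ x))) • η x := by
  rw [bivectorBracket_eq, bivectorBracket_eq, app_smul, app_smul]
  simp only [ContMDiffSection.coe_sub, Pi.sub_apply, smul_apply, lieForm_smul_apply, app_apply]
  module

end LieAlgebroidModule

variable {𝓥 : LieAlgebroidModule 𝓐 FV V}
  {FC : Type*} [NormedAddCommGroup FC] [NormedSpace ℝ FC] [FiniteDimensional ℝ FC]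
  {C : M → Type*} [TopologicalSpace (Bundle.TotalSpace FC C)]
  [∀ x, AddCommGroup (C x)] [∀ x, Module ℝ (C x)] [∀ x, TopologicalSpace (C x)]
  [∀ x, IsTopologicalAddGroup (C x)] [∀ x, ContinuousSMul ℝ (C x)]
  [FiberBundle FC C] [VectorBundle ℝ FC C] [ContMDiffVectorBundle ∞ FC C I]

namespace AVCourantAlgebroid

variable (𝓒 : AVCourantAlgebroid 𝓥 FC C)

/-! ### The Courant bracket with sections of j(V ⊗ A^*). -/

section Bracket

variable [Nontrivial FV]

/-- Pairing with j(V ⊗ A^*) tests πc against all V-valued forms, which detect it because V is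
nonzero. Hence c = jζ, and pairing with arbitrary e tests ζ on all of A, as π is onto. -/
theorem eq_zero_of_pairing_eq_zero (x : M) (c : C x) (h : ∀ e, 𝓒.pairing x c e = 0) : c = 0 := by
  have h1 : 𝓒.proj x c = 0 := eq_zero_of_forall_hom_eq_zero F FV (W := V) x _
    fun η ↦ by rw [← 𝓒.pairing_inj, h]
  obtain ⟨ζ, rfl⟩ := (𝓒.proj_eq_zero_iff x c).1 h1
  have h2 : ζ = 0 := by
    ext v
    obtain ⟨e, rfl⟩ := 𝓒.proj_surjective x v
    rw [← 𝓒.pairing_inj, 𝓒.pairing_symm, h]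
    rfl
  rw [h2, map_zero]

/-- The pairing is nondegenerate on sections. -/
theorem section_ext {c c' : Cₛ^∞⟮I; FC, C⟯}
    (h : ∀ e, app (app 𝓒.pairing c) e = app (app 𝓒.pairing c') e) : c = c' := by
  ext x
  rw [← sub_eq_zero]
  refine 𝓒.eq_zero_of_pairing_eq_zero x _ fun v ↦ ?_
  obtain ⟨e, rfl⟩ := exists_section_eq (I := I) (F := FC) x v
  have h1 := congrArg (fun s ↦ s x) (h e)
  simp only [app_apply] at h1
  simp [h1]

theorem pairing_inj_left (ξ : Cₛ^∞⟮I; F →L[ℝ] FV, fun x ↦ A x →L[ℝ] V x⟯)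
    (e : Cₛ^∞⟮I; FC, C⟯) : app (app 𝓒.pairing (app 𝓒.inj ξ)) e = app ξ (app 𝓒.proj e) := by
  ext x
  exact (𝓒.pairing_symm x _ _).trans (𝓒.pairing_inj x _ _)

theorem pairing_inj_right (ξ : Cₛ^∞⟮I; F →L[ℝ] FV, fun x ↦ A x →L[ℝ] V x⟯)
    (e : Cₛ^∞⟮I; FC, C⟯) : app (app 𝓒.pairing e) (app 𝓒.inj ξ) = app ξ (app 𝓒.proj e) := by
  ext x
  exact 𝓒.pairing_inj x _ _

theorem app_proj_inj (ξ : Cₛ^∞⟮I; F →L[ℝ] FV, fun x ↦ A x →L[ℝ] V x⟯) :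
    app 𝓒.proj (app 𝓒.inj ξ) = 0 := by
  ext x
  exact 𝓒.proj_inj x _

theorem app_inj_injective : Function.Injective (app 𝓒.inj) := fun ξ η h ↦ by
  ext1 x
  exact 𝓒.inj_injective x (congrArg (fun s ↦ s x) h)

/-- Polarization of [e, e] = ½ j d⟨e, e⟩. -/
theorem bracket_add_bracket (e₁ e₂ : Cₛ^∞⟮I; FC, C⟯) :
    𝓒.bracket e₁ e₂ + 𝓒.bracket e₂ e₁ = app 𝓒.inj (𝓥.d₀ (app (app 𝓒.pairing e₁) e₂)) := by
  have h := 𝓒.bracket_self (e₁ + e₂)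
  have hs : app (app 𝓒.pairing e₂) e₁ = app (app 𝓒.pairing e₁) e₂ := by
    ext x
    exact 𝓒.pairing_symm x _ _
  simp only [map_add, LinearMap.add_apply, app_add, add_app, 𝓥.d₀_add, hs, smul_add,
    ← 𝓒.bracket_self] at h
  have h2 : 𝓒.bracket e₁ e₂ + 𝓒.bracket e₂ e₁ =
      (1 / 2 : ℝ) • app 𝓒.inj (𝓥.d₀ (app (app 𝓒.pairing e₁) e₂)) +
      (1 / 2 : ℝ) • app 𝓒.inj (𝓥.d₀ (app (app 𝓒.pairing e₁) e₂)) := by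
    rw [← sub_eq_zero] at h ⊢
    rw [← h]
    abel
  rw [h2]
  module

/-- Pairing both sides with e' reduces the claim to the invariance of the pairing, which for jη is
the defining formula of the Lie derivative of η. -/
theorem bracket_inj_right (e : Cₛ^∞⟮I; FC, C⟯)
    (η : Cₛ^∞⟮I; F →L[ℝ] FV, fun x ↦ A x →L[ℝ] V x⟯) :
    𝓒.bracket e (app 𝓒.inj η) = app 𝓒.inj (𝓥.lieForm (app 𝓒.proj e) η) :=
  𝓒.section_ext fun e' ↦ by
    have h := 𝓒.lie_pairing e (app 𝓒.inj η) e'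
    rw [pairing_inj_left, pairing_inj_left, 𝓒.proj_bracket] at h
    rw [pairing_inj_left, 𝓥.app_lieForm, h, add_sub_cancel_right]

/-- By the symmetrized bracket this is j(d ι_{πe} η - 𝓛_{πe} η), to which Cartan's formula applies.
-/
theorem bracket_inj_left (e : Cₛ^∞⟮I; FC, C⟯)
    (η : Cₛ^∞⟮I; F →L[ℝ] FV, fun x ↦ A x →L[ℝ] V x⟯) :
    𝓒.bracket (app 𝓒.inj η) e = -app 𝓒.inj (app (𝓥.d₁ η) (app 𝓒.proj e)) := by
  have h := 𝓒.bracket_add_bracket e (app 𝓒.inj η)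
  rw [bracket_inj_right, pairing_inj_right, ← 𝓥.app_d₁_add_d₀, app_add] at h
  rw [← sub_eq_zero] at h ⊢
  rw [← h]
  abel

theorem bracket_inj_inj (ξ η : Cₛ^∞⟮I; F →L[ℝ] FV, fun x ↦ A x →L[ℝ] V x⟯) :
    𝓒.bracket (app 𝓒.inj ξ) (app 𝓒.inj η) = 0 := by
  rw [bracket_inj_left, app_proj_inj, app_zero, app_zero, neg_zero]

/-- The image under `j` of the bracket of 1-forms is the derivative of the bracket of `C`. -/
theorem inj_bivectorBracket
    {P : Cₛ^∞⟮I; (F →L[ℝ] FV) →L[ℝ] F, fun x ↦ (A x →L[ℝ] V x) →L[ℝ] A x⟯}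
    {ξ η : Cₛ^∞⟮I; F →L[ℝ] FV, fun x ↦ A x →L[ℝ] V x⟯} {e e' : Cₛ^∞⟮I; FC, C⟯}
    (h : app 𝓒.proj e = app P ξ) (h' : app 𝓒.proj e' = app P η) :
    app 𝓒.inj (𝓥.bivectorBracket P ξ η) =
      𝓒.bracket (app 𝓒.inj ξ) e' + 𝓒.bracket e (app 𝓒.inj η) := by
  rw [bracket_inj_left, bracket_inj_right, h, h', 𝓥.bivectorBracket_eq, app_sub]
  abel

end Bracket

variable {𝓒} {H : ∀ x, Submodule ℝ (A x)}

/-! ### Membership in L in terms of real and imaginary parts. -/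

section ComplexSubbundle

variable (J : ∀ x, 𝓒.Quot H x →ₗ[ℝ] 𝓒.Quot H x)

theorem tmul_mem_complexSubbundle (x : M) (a b : 𝓒.preimage H x)
    (hab : J x (𝓒.q H x a) = -𝓒.q H x b) (hba : J x (𝓒.q H x b) = 𝓒.q H x a) :
    (1 : ℂ) ⊗ₜ[ℝ] (a : C x) + Complex.I ⊗ₜ[ℝ] (b : C x) ∈ 𝓒.complexSubbundle J x := by
  refine ⟨(1 : ℂ) ⊗ₜ[ℝ] a + Complex.I ⊗ₜ[ℝ] b, ?_, by simp⟩
  simp [hab, hba, TensorProduct.smul_tmul', TensorProduct.tmul_neg, TensorProduct.neg_tmul,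
    add_comm]

/-- The real part of 𝕁w = i w is 𝕁(Re w) = -Im w. Taking real and imaginary parts commutes with the
inclusion of π⁻¹(H), so those of w are a and b. -/
theorem exists_of_tmul_mem_complexSubbundle (x : M) (a b : C x)
    (h : (1 : ℂ) ⊗ₜ[ℝ] a + Complex.I ⊗ₜ[ℝ] b ∈ 𝓒.complexSubbundle J x) :
    ∃ (ha : a ∈ 𝓒.preimage H x) (hb : b ∈ 𝓒.preimage H x),
      J x (𝓒.q H x ⟨a, ha⟩) = -𝓒.q H x ⟨b, hb⟩ := by
  obtain ⟨w, hw, hwe⟩ := h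
  have ha : (tensorRe (𝓒.preimage H x) w : C x) = a := by
    have := congrArg (tensorRe (C x)) hwe
    rw [tensorRe_baseChange] at this
    simpa using this
  have hb : (tensorIm (𝓒.preimage H x) w : C x) = b := by
    have := congrArg (tensorIm (C x)) hwe
    rw [tensorIm_baseChange] at this
    simpa using this
  subst ha hb
  refine ⟨Subtype.prop _, Subtype.prop _, ?_⟩
  have hw' : (J x).baseChange ℂ ((𝓒.q H x).baseChange ℂ w) =
      Complex.I • (𝓒.q H x).baseChange ℂ w := sub_eq_zero.1 hw
  have := congrArg (tensorRe _) hw'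
  rwa [tensorRe_I_smul, tensorRe_baseChange, tensorRe_baseChange, tensorIm_baseChange] at this

end ComplexSubbundle

/-! ### Lifts of 𝕁 q jξ, the bivector P, and the Lie algebroid V ⊗ A^*. -/

namespace GeneralizedCRStructure

variable (𝕁 : 𝓒.GeneralizedCRStructure H)

/-- `e` is a section of `π⁻¹(H)` that represents the section `𝕁 (q (j ξ))` of `ℍ`. -/
def Represents (ξ : Cₛ^∞⟮I; F →L[ℝ] FV, fun x ↦ A x →L[ℝ] V x⟯) (e : Cₛ^∞⟮I; FC, C⟯) : Prop :=
  ∀ x, ∃ h : e x ∈ 𝓒.preimage H x, 𝕁.J x (𝓒.quotInj H x (ξ x)) = 𝓒.q H x ⟨e x, h⟩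

theorem exists_represents (ξ : Cₛ^∞⟮I; F →L[ℝ] FV, fun x ↦ A x →L[ℝ] V x⟯) :
    ∃ e, 𝕁.Represents ξ e :=
  𝕁.smooth (fun x ↦ 𝓒.quotInj H x (ξ x))
    ⟨app 𝓒.inj ξ, fun x ↦ ⟨𝓒.inj_mem_preimage H x _, rfl⟩⟩

-- A lift is determined only modulo j(V ⊗ Ann H), which π kills, so its image in A does not depend
-- on the choice.
variable {𝕁} in
theorem Represents.proj_apply {ξ : Cₛ^∞⟮I; F →L[ℝ] FV, fun x ↦ A x →L[ℝ] V x⟯}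
    {e : Cₛ^∞⟮I; FC, C⟯} (h : 𝕁.Represents ξ e) (x : M) :
    𝓒.proj x (e x) = 𝕁.bivector x (ξ x) := by
  obtain ⟨_, h⟩ := h x
  exact (congrArg (𝓒.quotProj H x) h).symm

/-- Orthogonality and 𝕁² = -1 give ⟨𝕁u, v⟩ = ⟨𝕁²u, 𝕁v⟩ = -⟨u, 𝕁v⟩. Take u = q jξ, v = q jη and use
⟨u, q jη⟩ = η(πu). -/
theorem bivector_skew (x : M) (ξ η : A x →L[ℝ] V x) :
    η (𝕁.bivector x ξ) = -ξ (𝕁.bivector x η) := by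
  have key (u : 𝓒.Quot H x) (η : A x →L[ℝ] V x) :
      𝓒.quotPairing H x u (𝓒.quotInj H x η) = η (𝓒.quotProj H x u) := by
    obtain ⟨u, rfl⟩ := Submodule.mkQ_surjective _ u
    exact 𝓒.pairing_inj x _ _
  have symm (u v : 𝓒.Quot H x) : 𝓒.quotPairing H x u v = 𝓒.quotPairing H x v u := by
    obtain ⟨u, rfl⟩ := Submodule.mkQ_surjective _ u
    obtain ⟨v, rfl⟩ := Submodule.mkQ_surjective _ v
    exact 𝓒.pairing_symm x _ _
  change η (𝓒.quotProj H x (𝕁.J x (𝓒.quotInj H x ξ))) =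
    -ξ (𝓒.quotProj H x (𝕁.J x (𝓒.quotInj H x η)))
  rw [← key, ← key, ← 𝕁.orthogonal, 𝕁.sq, map_neg, LinearMap.neg_apply, symm]

/-- The chosen lifts need not depend linearly on ξ, but their projections to A do, since these are
given by a fibrewise linear map. Smoothness then follows from tensoriality. -/
theorem exists_bivector_section [FiniteDimensional ℝ FV] :
    ∃ P : Cₛ^∞⟮I; (F →L[ℝ] FV) →L[ℝ] F, fun x ↦ (A x →L[ℝ] V x) →L[ℝ] A x⟯,
      ∀ x ξ, P x ξ = 𝕁.bivector x ξ := by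
  choose e he using 𝕁.exists_represents
  have hΦ (ξ) (x) : app 𝓒.proj (e ξ) x = 𝕁.bivector x (ξ x) := (he ξ).proj_apply x
  let P := ofTensorial (fun ξ ↦ app 𝓒.proj (e ξ))
    (fun ξ η ↦ by
      ext x
      simp only [hΦ, ContMDiffSection.coe_add, Pi.add_apply, map_add])
    (fun f ξ ↦ by
      ext x
      simp only [hΦ, smul_apply, map_smul])
  refine ⟨P, fun x ξ ↦ ?_⟩
  obtain ⟨ξ, rfl⟩ := exists_section_eq (I := I) (F := F →L[ℝ] FV)
    (A := fun x ↦ A x →L[ℝ] V x) x ξ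
  rw [← hΦ]
  exact ofTensorial_apply (F := F →L[ℝ] FV) (A := fun x ↦ A x →L[ℝ] V x) _ _ _ ξ x

variable [Nontrivial FV]
  {P : Cₛ^∞⟮I; (F →L[ℝ] FV) →L[ℝ] F, fun x ↦ (A x →L[ℝ] V x) →L[ℝ] A x⟯}

variable {𝕁}

theorem Represents.proj_eq (hP : ∀ x ξ, P x ξ = 𝕁.bivector x ξ)
    {ξ : Cₛ^∞⟮I; F →L[ℝ] FV, fun x ↦ A x →L[ℝ] V x⟯} {e : Cₛ^∞⟮I; FC, C⟯}
    (h : 𝕁.Represents ξ e) : app 𝓒.proj e = app P ξ := by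
  ext x
  exact (h.proj_apply x).trans (hP x _).symm

/-- In ℂ ⊗ ℍ this is (1 - i𝕁) applied to q jξ, hence an eigenvector of 𝕁 for i. -/
theorem Represents.tmul_mem {ξ : Cₛ^∞⟮I; F →L[ℝ] FV, fun x ↦ A x →L[ℝ] V x⟯}
    {e : Cₛ^∞⟮I; FC, C⟯} (h : 𝕁.Represents ξ e) (x : M) :
    (evalAt x).baseChange ℂ ((1 : ℂ) ⊗ₜ[ℝ] app 𝓒.inj ξ + Complex.I ⊗ₜ[ℝ] (-e)) ∈
      𝓒.complexSubbundle 𝕁.J x := by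
  obtain ⟨hm, h⟩ := h x
  have := tmul_mem_complexSubbundle 𝕁.J x ⟨𝓒.inj x (ξ x), 𝓒.inj_mem_preimage H x _⟩
    (-⟨e x, hm⟩) (by rw [map_neg, neg_neg]; exact h)
    (by rw [map_neg, map_neg, ← h, 𝕁.sq, neg_neg]; rfl)
  rw [map_add, LinearMap.baseChange_tmul, LinearMap.baseChange_tmul]
  exact this

/-- Involutivity: the bracket of representatives represents the bracket. -/
theorem Represents.bracket (hP : ∀ x ξ, P x ξ = 𝕁.bivector x ξ)
    {ξ η : Cₛ^∞⟮I; F →L[ℝ] FV, fun x ↦ A x →L[ℝ] V x⟯} {e e' : Cₛ^∞⟮I; FC, C⟯}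
    (h : 𝕁.Represents ξ e) (h' : 𝕁.Represents η e') :
    𝕁.Represents (𝓥.bivectorBracket P ξ η) (𝓒.bracket e e') := by
  intro x
  have h1 := 𝕁.involutive _ _ h.tmul_mem h'.tmul_mem x
  -- The product of the real parts vanishes by `bracket_inj_inj`, that of the imaginary parts gains
  -- i² = -1, and the mixed terms combine to j of the bracket of forms.
  have h2 : LinearMap.BilinMap.baseChange ℂ 𝓒.bracket
      ((1 : ℂ) ⊗ₜ[ℝ] app 𝓒.inj ξ + Complex.I ⊗ₜ[ℝ] (-e))
      ((1 : ℂ) ⊗ₜ[ℝ] app 𝓒.inj η + Complex.I ⊗ₜ[ℝ] (-e')) =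
      (1 : ℂ) ⊗ₜ[ℝ] (-𝓒.bracket e e') +
        Complex.I ⊗ₜ[ℝ] (-app 𝓒.inj (𝓥.bivectorBracket P ξ η)) := by
    rw [𝓒.inj_bivectorBracket (h.proj_eq hP) (h'.proj_eq hP)]
    simp only [map_add, LinearMap.add_apply, LinearMap.BilinMap.baseChange_tmul, map_neg,
      LinearMap.neg_apply, bracket_inj_inj, neg_neg, mul_one, one_mul, Complex.I_mul_I,
      TensorProduct.tmul_neg, TensorProduct.neg_tmul, TensorProduct.tmul_add,
      TensorProduct.tmul_zero]
    abel
  rw [h2, map_add, LinearMap.baseChange_tmul, LinearMap.baseChange_tmul] at h1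
  obtain ⟨ha, hb, hab⟩ := exists_of_tmul_mem_complexSubbundle 𝕁.J x _ _ h1
  have ha' : 𝓒.bracket e e' x ∈ 𝓒.preimage H x := neg_mem_iff.1 ha
  refine ⟨ha', ?_⟩
  -- Involutivity evaluates 𝕁 on q[e, e']; one more application of 𝕁 inverts this, as 𝕁² = -1.
  have h3 : -𝕁.J x (𝓒.q H x ⟨_, ha'⟩) = 𝓒.quotInj H x (𝓥.bivectorBracket P ξ η x) := by
    rw [← map_neg, ← map_neg]
    refine hab.trans ?_
    rw [← map_neg]
    refine congrArg _ (Subtype.ext ?_)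
    exact neg_neg _
  rw [← h3, map_neg, 𝕁.sq, neg_neg]

theorem app_bivectorBracket (hP : ∀ x ξ, P x ξ = 𝕁.bivector x ξ)
    (ξ η : Cₛ^∞⟮I; F →L[ℝ] FV, fun x ↦ A x →L[ℝ] V x⟯) :
    app P (𝓥.bivectorBracket P ξ η) = 𝓐.bracket (app P ξ) (app P η) := by
  obtain ⟨e, he⟩ := 𝕁.exists_represents ξ
  obtain ⟨e', he'⟩ := 𝕁.exists_represents η
  rw [← (he.bracket hP he').proj_eq hP, 𝓒.proj_bracket, he.proj_eq hP, he'.proj_eq hP]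

/-- Since j is injective, it suffices to compare images under j. There j[ξ, [η, ζ]] = [jξ, [e₂, e₃]]
+ [e₁, [jη, e₃]] + [e₁, [e₂, jζ]], because [e₂, e₃] is a lift for [η, ζ]; the other two double
brackets expand likewise. -/
theorem bivectorBracket_jacobi (hP : ∀ x ξ, P x ξ = 𝕁.bivector x ξ)
    (ξ η ζ : Cₛ^∞⟮I; F →L[ℝ] FV, fun x ↦ A x →L[ℝ] V x⟯) :
    𝓥.bivectorBracket P ξ (𝓥.bivectorBracket P η ζ) =
      𝓥.bivectorBracket P (𝓥.bivectorBracket P ξ η) ζ +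
        𝓥.bivectorBracket P η (𝓥.bivectorBracket P ξ ζ) := by
  obtain ⟨e₁, h₁⟩ := 𝕁.exists_represents ξ
  obtain ⟨e₂, h₂⟩ := 𝕁.exists_represents η
  obtain ⟨e₃, h₃⟩ := 𝕁.exists_represents ζ
  have p₁ := h₁.proj_eq hP
  have p₂ := h₂.proj_eq hP
  have p₃ := h₃.proj_eq hP
  refine 𝓒.app_inj_injective ?_
  rw [app_add, 𝓒.inj_bivectorBracket p₁ ((h₂.bracket hP h₃).proj_eq hP),
    𝓒.inj_bivectorBracket ((h₁.bracket hP h₂).proj_eq hP) p₃,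
    𝓒.inj_bivectorBracket p₂ ((h₁.bracket hP h₃).proj_eq hP),
    𝓒.inj_bivectorBracket p₁ p₂, 𝓒.inj_bivectorBracket p₁ p₃, 𝓒.inj_bivectorBracket p₂ p₃]
  simp only [map_add, LinearMap.add_apply]
  -- One Jacobi identity for each position of j.
  rw [𝓒.jacobi (app 𝓒.inj ξ) e₂ e₃, 𝓒.jacobi e₁ (app 𝓒.inj η) e₃, 𝓒.jacobi e₁ e₂ (app 𝓒.inj ζ)]
  abel

/-- The Lie algebroid structure on `V ⊗ A^*` determined by a generalized CR structure. -/
def lieAlgebroid [FiniteDimensional ℝ FV] (hP : ∀ x ξ, P x ξ = 𝕁.bivector x ξ) :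
    LieAlgebroid I (F →L[ℝ] FV) (fun x ↦ A x →L[ℝ] V x) where
  anchor := ofTensorial (fun ξ ↦ app 𝓐.anchor (app P ξ)) (fun ξ η ↦ by simp only [app_add])
    (fun f ξ ↦ by simp only [app_smul])
  bracket := 𝓥.bivectorBracket P
  bracket_self := 𝓥.bivectorBracket_self P fun x ξ η ↦ by
    rw [hP, hP]
    exact 𝕁.bivector_skew x ξ η
  jacobi := bivectorBracket_jacobi hP
  leibniz ξ f η x := by
    rw [𝓥.bivectorBracket_leibniz, ofTensorial_apply]
    rfl
  anchor_bracket ξ η x := by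
    simp only [ofTensorial_apply]
    -- P preserves brackets, so the anchor a ∘ P inherits compatibility from a.
    rw [app_bivectorBracket hP]
    exact 𝓐.anchor_bracket _ _ x

theorem lieAlgebroid_anchor [FiniteDimensional ℝ FV] (hP : ∀ x ξ, P x ξ = 𝕁.bivector x ξ)
    (x : M) (ξ : A x →L[ℝ] V x) : (lieAlgebroid hP).anchor x ξ = 𝓐.anchor x (P x ξ) := by
  obtain ⟨ξ, rfl⟩ := exists_section_eq (I := I) (F := F →L[ℝ] FV)
    (A := fun x ↦ A x →L[ℝ] V x) x ξ
  exact ofTensorial_apply (fun ξ ↦ app 𝓐.anchor (app P ξ)) (fun ξ η ↦ by simp only [app_add])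
    (fun f ξ ↦ by simp only [app_smul]) ξ x

end GeneralizedCRStructure

end AVCourantAlgebroid

end Algebroids
end AVC

end

theorem mainTheorem4
    {E : Type*} [NormedAddCommGroup E] [NormedSpace ℝ E] [FiniteDimensional ℝ E]
    {HM : Type*} [TopologicalSpace HM] {I : ModelWithCorners ℝ E HM} [I.Boundaryless]
    {M : Type*} [TopologicalSpace M] [ChartedSpace HM M] [IsManifold I ∞ M]
    [T2Space M] [SigmaCompactSpace M]
    -- the vector bundle `A`
    {F : Type*} [NormedAddCommGroup F] [NormedSpace ℝ F] [FiniteDimensional ℝ F]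
    {A : M → Type*} [TopologicalSpace (Bundle.TotalSpace F A)]
    [∀ x, AddCommGroup (A x)] [∀ x, Module ℝ (A x)] [∀ x, TopologicalSpace (A x)]
    [∀ x, IsTopologicalAddGroup (A x)] [∀ x, ContinuousSMul ℝ (A x)]
    [FiberBundle F A] [VectorBundle ℝ F A] [ContMDiffVectorBundle ∞ F A I]
    -- the line bundle `V`
    {FV : Type*} [NormedAddCommGroup FV] [NormedSpace ℝ FV] [FiniteDimensional ℝ FV]
    (hFV : Module.finrank ℝ FV = 1)
    {V : M → Type*} [TopologicalSpace (Bundle.TotalSpace FV V)]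
    [∀ x, AddCommGroup (V x)] [∀ x, Module ℝ (V x)] [∀ x, TopologicalSpace (V x)]
    [∀ x, IsTopologicalAddGroup (V x)] [∀ x, ContinuousSMul ℝ (V x)]
    [FiberBundle FV V] [VectorBundle ℝ FV V] [ContMDiffVectorBundle ∞ FV V I]
    -- the vector bundle `C`
    {FC : Type*} [NormedAddCommGroup FC] [NormedSpace ℝ FC] [FiniteDimensional ℝ FC]
    {C : M → Type*} [TopologicalSpace (Bundle.TotalSpace FC C)]
    [∀ x, AddCommGroup (C x)] [∀ x, Module ℝ (C x)] [∀ x, TopologicalSpace (C x)]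
    [∀ x, IsTopologicalAddGroup (C x)] [∀ x, ContinuousSMul ℝ (C x)]
    [FiberBundle FC C] [VectorBundle ℝ FC C] [ContMDiffVectorBundle ∞ FC C I]
    (𝓐 : AVC.LieAlgebroid I F A) (𝓥 : AVC.LieAlgebroidModule 𝓐 FV V)
    (𝓒 : AVC.AVCourantAlgebroid 𝓥 FC C)
    (H : ∀ x, Submodule ℝ (A x)) (hH : AVC.IsSmoothSubbundle I F H)
    (𝕁 : 𝓒.GeneralizedCRStructure H) :
    ∃ P : Cₛ^∞⟮I; (F →L[ℝ] FV) →L[ℝ] F, fun x ↦ (A x →L[ℝ] V x) →L[ℝ] A x⟯,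
      (∀ x ξ, P x ξ = 𝕁.bivector x ξ) ∧
      (∀ x (ξ η : A x →L[ℝ] V x), η (P x ξ) = -ξ (P x η)) ∧
      ∃ 𝓛 : AVC.LieAlgebroid I (F →L[ℝ] FV) (fun x ↦ A x →L[ℝ] V x),
        (∀ x ξ, 𝓛.anchor x ξ = 𝓐.anchor x (P x ξ)) ∧
        (∀ ξ η, 𝓛.bracket ξ η =
          AVC.app (𝓥.d₁ η) (AVC.app P ξ) - AVC.app (𝓥.d₁ ξ) (AVC.app P η) +
            𝓥.d₀ (AVC.app η (AVC.app P ξ))) ∧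
        AVC.IsLieAlgebroidMorphism 𝓛 𝓐 P := by
  obtain ⟨P, hP⟩ := 𝕁.exists_bivector_section
  -- Rank one makes V nonzero, as the nondegeneracy of the pairing requires.
  have : Nontrivial FV := Module.nontrivial_of_finrank_eq_succ hFV
  refine ⟨P, hP, fun x ξ η ↦ ?_, AVC.AVCourantAlgebroid.GeneralizedCRStructure.lieAlgebroid hP,
    AVC.AVCourantAlgebroid.GeneralizedCRStructure.lieAlgebroid_anchor hP, fun ξ η ↦ rfl,
    fun x ξ ↦ ?_, AVC.AVCourantAlgebroid.GeneralizedCRStructure.app_bivectorBracket hP⟩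
  · rw [hP, hP]
    exact 𝕁.bivector_skew x ξ η
  · exact (AVC.AVCourantAlgebroid.GeneralizedCRStructure.lieAlgebroid_anchor hP x ξ).symm
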